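/- Let $N,J\ge 1$ be integers and put $e(t)=e^{2\pi i t}$. For $f:\mathbb{C}^N\to\mathbb{C}$ let $$\mathbb{E}_{\mathrm{ACUE}(N)}[f]=\frac{1}{N!\,(2N)^N}\sum_{t_1,\dots,t_N} f(e(t_1),\dots,e(t_N))\prod_{1\le j<k\le N}|e(t_j)-e(t_k)|^2,$$ where each $t_i$ runs over $\{0,\tfrac1{2N},\dots,\tfrac{2N-1}{2N}\}$, and write $g=\mathrm{diag}(z_1,\dots,z_N)$ for the diagonal matrix of the arguments $z_i$ of $f$. Let $v_1,\dots,v_J$ be complex numbers and let $u_1,\dots,u_J$ be complex numbers that are not $2N$-th roots of unity, with $v_i\ne u_j$ for all $i,j$. Put $$\mathfrak{e}_N(u,v)=\frac{1-u^Nv^N}{1-u^{2N}}.$$ Then $$\mathbb{E}_{\mathrm{ACUE}(N)}\left[\frac{\prod_{j=1}^J\det(1+v_jg)}{\prod_{j=1}^J\det(1+u_jg)}\right]=\frac{1}{\det\left(\frac{1}{u_i-v_j}\right)_{i,j=1}^{J}}\,\det\left(\frac{1}{u_i-v_j}\,\mathfrak{e}_N(u_i,v_j)\right)_{i,j=1}^{J}$$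 in the following sense. If the $u_i$ are pairwise distinct and the $v_j$ are pairwise distinct, then the determinant in the denominator is nonzero and the equality holds. In general, the left-hand side (at the given $u,v$) is the limit of the right-hand side as $(u',v')\to(u,v)$ in $\mathbb{C}^J\times\mathbb{C}^J$ through points such that the $u'_i$ are pairwise distinct and the $v'_j$ are pairwise distinct. -/

import Mathlib

open Filter Topology
open scoped Nat

noncomputable section

namespace ACUE

/-- `e(t) = exp(2πit)`. -/
def e (t : ℝ) : ℂ := Complex.exp (2 * Real.pi * Complex.I * t)

/-- The Vandermonde product `Δ(x₁, …, x_N) = ∏_{j < k} (x_j - x_k)`. -/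
def vandermondeProd {N : ℕ} (x : Fin N → ℂ) : ℂ :=
  ∏ j : Fin N, ∏ k ∈ Finset.Ioi j, (x j - x k)

/-- The `N` points `e(m_i / 2N)`, `i = 1, …, N`, among the `2N`-th roots of unity, that belong to
the indices `m_i ∈ {0, …, 2N - 1}`. -/
def points (N : ℕ) (m : Fin N → Fin (2 * N)) : Fin N → ℂ :=
  fun i => e (((m i : ℕ) : ℝ) / (2 * (N : ℝ)))

/-- The average `𝔼_{ACUE(N)} [f(e(ϑ₁), …, e(ϑ_N))]`, that is, `1 / (N! (2N)^N)` times the sum of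
`f(e(t₁), …, e(t_N)) |Δ(e(t₁), …, e(t_N))|²` over all `t₁, …, t_N` in
`{0, 1/2N, …, (2N - 1)/2N}`. -/
def expectation (N : ℕ) (f : (Fin N → ℂ) → ℂ) : ℂ :=
  1 / (N ! : ℂ) * (1 / (2 * (N : ℂ)) ^ N) *
    ∑ m : Fin N → Fin (2 * N),
      f (points N m) * ((‖vandermondeProd (points N m)‖ ^ 2 : ℝ) : ℂ)

/-- `det(1 + w g)`, where `g = diag(z₁, …, z_N)`. -/
def charDet {N : ℕ} (w : ℂ) (z : Fin N → ℂ) : ℂ :=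
  (1 + w • Matrix.diagonal z : Matrix (Fin N) (Fin N) ℂ).det

/-- The average of the ratio `∏_j det(1 + v_j g) / ∏_j det(1 + u_j g)`. -/
def ratioAverage (N : ℕ) {J : ℕ} (u v : Fin J → ℂ) : ℂ :=
  expectation N fun z => (∏ j, charDet (v j) z) / ∏ j, charDet (u j) z

/-- `𝔢_N(u, v) = (1 - u^N v^N) / (1 - u^{2N})`. -/
def frakE (N : ℕ) (u v : ℂ) : ℂ := (1 - u ^ N * v ^ N) / (1 - u ^ (2 * N))

/-- `det(1 / (u_i - v_j))`. -/
def cauchyDet {J : ℕ} (u v : Fin J → ℂ) : ℂ :=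
  (Matrix.of fun i j : Fin J => 1 / (u i - v j)).det

/-- `det(𝔢_N(u_i, v_j) / (u_i - v_j))`. -/
def weightedDet (N : ℕ) {J : ℕ} (u v : Fin J → ℂ) : ℂ :=
  (Matrix.of fun i j : Fin J => 1 / (u i - v j) * frakE N (u i) (v j)).det

end ACUE

end

open Polynomial

namespace ACUE

/-! With `A = linearProd v` and `B = linearProd u`, the ratio at each point `z` is `A(1/z) /
B(1/z)`. Andréief's identity therefore turns the average into the `N × N` determinant of `L_b (A
X^a)`, where `L_b` is `weightedCoeff` (`ratioAverage_eq_det`).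

On polynomials of degree `< N + J`, `det_pairing_exchange` compares two families of vectors: `A
X^a`, `X^k` and `B X^a`, `interpolant i`. They are paired with `L_b` and evaluation at `-v_j`, or
with top coefficients and evaluation at `-u_j`. Every pairing matrix is block triangular, because
`L_b` is dual to `B X^a` and kills the interpolants. What remains is the determinant of the
interpolants at `-v_j`, a Cauchy matrix weighted by `1 - u_i^N v_j^N`. The unweighted exchange
evaluates the Cauchy determinant, and the common factors cancel.

For coinciding parameters, the average is continuous at `(u, v)`, which gives the limit. -/

/-! ### Determinant identities and orthogonality of roots of unity -/

/-- Andréief's identity for a finite sum. -/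
theorem sum_prod_mul_det_mul_det {R ι κ : Type*} [CommRing R] [Fintype ι] [DecidableEq ι]
    [Fintype κ] [DecidableEq κ] (h : κ → R) (F G : ι → κ → R) :
    ∑ m : ι → κ, (∏ i, h (m i)) * ((Matrix.of fun i a => F a (m i)).det *
      (Matrix.of fun i b => G b (m i)).det) =
    ((Fintype.card ι)! : R) * (Matrix.of fun a b => ∑ x, h x * F a x * G b x).det := by
  have key : ∀ σ : Equiv.Perm ι, ∀ m : ι → κ,
      (∏ i, h (m i)) * (((Equiv.Perm.sign σ : ℤ) : R) * ∏ i, F (σ i) (m i)) *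
        (Matrix.of fun i b => G b (m i)).det =
      ((Equiv.Perm.sign σ : ℤ) : R) *
        (Matrix.of fun i b => h (m i) * F (σ i) (m i) * G b (m i)).det := by
    intro σ m
    rw [show (Matrix.of fun i b => h (m i) * F (σ i) (m i) * G b (m i)) =
      Matrix.of fun i b => (h (m i) * F (σ i) (m i)) * (Matrix.of fun i b => G b (m i)) i b
      from rfl, Matrix.det_mul_column, Finset.prod_mul_distrib]
    ring
  -- Row `i` depends on `m i` alone, so the sum over `m` moves inside the determinant; undoing `σ`
  -- costs a second sign, and all `σ` contribute equally.
  have key2 : ∀ σ : Equiv.Perm ι,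
      ∑ m : ι → κ, (Matrix.of fun i b => h (m i) * F (σ i) (m i) * G b (m i)).det =
      ((Equiv.Perm.sign σ : ℤ) : R) *
        (Matrix.of fun a b => ∑ x, h x * F a x * G b x).det := by
    intro σ
    rw [← Matrix.det_permute, ← Matrix.det_transpose (Matrix.submatrix _ _ _)]
    simp_rw [← fun m : ι → κ => Matrix.det_transpose
      (Matrix.of fun i b => h (m i) * F (σ i) (m i) * G b (m i))]
    simp_rw [Matrix.det_apply']
    rw [Finset.sum_comm]
    refine Finset.sum_congr rfl fun τ _ => ?_
    rw [← Finset.mul_sum]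
    congr 1
    simp [Finset.prod_univ_sum]
  calc _ = ∑ m : ι → κ, ∑ σ : Equiv.Perm ι, ((Equiv.Perm.sign σ : ℤ) : R) *
        (Matrix.of fun i b => h (m i) * F (σ i) (m i) * G b (m i)).det := by
        refine Finset.sum_congr rfl fun m _ => ?_
        simp_rw [← key, ← Finset.sum_mul, ← Finset.mul_sum]
        rw [← Matrix.det_transpose (Matrix.of fun i a => F a (m i)),
          Matrix.det_apply' (Matrix.transpose _)]
        simp [mul_assoc]
    _ = _ := by
        rw [Finset.sum_comm]
        simp_rw [← Finset.mul_sum, key2, ← mul_assoc]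
        have : ∀ σ : Equiv.Perm ι,
            ((Equiv.Perm.sign σ : ℤ) : R) * ((Equiv.Perm.sign σ : ℤ) : R) = 1 := by
          intro σ
          rw [← Int.cast_mul, ← Units.val_mul, Int.units_mul_self]; simp
        simp [this, Fintype.card_perm]

/-- For functionals `f`, `g` and vectors `p`, `r` in the `n`-dimensional space of polynomials of
degree less than `n`, the determinants of the pairings are multiplicative. -/
theorem det_pairing_exchange {R ι : Type*} [CommRing R] [Fintype ι] [DecidableEq ι] {n : ℕ}
    (hn : Fintype.card ι = n) (f g : ι → R[X] →ₗ[R] R) (p r : ι → R[X])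
    (hp : ∀ i, (p i).degree < n) (hr : ∀ i, (r i).degree < n) :
    (Matrix.of fun i j => f i (p j)).det * (Matrix.of fun i j => g i (r j)).det =
      (Matrix.of fun i j => f i (r j)).det * (Matrix.of fun i j => g i (p j)).det := by
  let e : ι ≃ Fin n := Fintype.equivFinOfCardEq hn
  -- Each pairing matrix factors through the monomial basis, so both sides are products of the same
  -- four determinants.
  have key : ∀ (f : ι → R[X] →ₗ[R] R) (p : ι → R[X]), (∀ i, (p i).degree < n) →
      (Matrix.of fun i j => f i (p j)) =
        (Matrix.of fun i k => f i (X ^ (e k : ℕ))) *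
          (Matrix.of fun k j => (p j).coeff (e k)) := by
    intro f p hp
    ext i j
    rw [Matrix.mul_apply]
    simp only [Matrix.of_apply]
    have h1 : p j = ∑ k : Fin n, (p j).coeff k • (X ^ (k : ℕ) : R[X]) := by
      have hpos : n ≠ 0 := hn ▸ (Fintype.card_pos_iff.mpr ⟨j⟩).ne'
      have hdeg : (p j).natDegree < n := by
        by_cases h0 : p j = 0
        · simpa [h0] using Nat.pos_of_ne_zero hpos
        · exact (natDegree_lt_iff_degree_lt h0).mpr (hp j)
      conv_lhs => rw [(p j).as_sum_range' n hdeg]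
      rw [Finset.sum_range]
      simp [smul_eq_C_mul, C_mul_X_pow_eq_monomial]
    conv_lhs => rw [h1]
    rw [map_sum, ← e.sum_comp]
    simp [mul_comm]
  rw [key f p hp, key g r hr, key f r hr, key g p hp]
  simp only [Matrix.det_mul]
  ring

theorem sum_pow_mul_inv_pow {n : ℕ} {ζ : ℂ} (hζ : IsPrimitiveRoot ζ n) {a b : ℕ} (ha : a < n)
    (hb : b < n) :
    ∑ x : Fin n, (ζ ^ (x : ℕ))⁻¹ ^ a * (ζ ^ (x : ℕ)) ^ b = if a = b then (n : ℂ) else 0 := by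
  have hn : n ≠ 0 := by omega
  have hζ0 : ζ ≠ 0 := hζ.ne_zero hn
  have h1 : ∀ x : Fin n, (ζ ^ (x : ℕ))⁻¹ ^ a * (ζ ^ (x : ℕ)) ^ b = (ζ ^ b / ζ ^ a) ^ (x : ℕ) := by
    intro x
    rw [div_pow, div_eq_mul_inv, inv_pow, ← pow_mul, ← pow_mul, ← pow_mul, ← pow_mul,
      mul_comm (x : ℕ), mul_comm (x : ℕ), mul_comm]
  simp_rw [h1]
  rw [← Finset.sum_range (fun x => (ζ ^ b / ζ ^ a) ^ x)]
  split_ifs with h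
  · subst h
    simp [hζ0]
  · have hne : ζ ^ b / ζ ^ a ≠ 1 := by
      rw [Ne, div_eq_one_iff_eq (pow_ne_zero _ hζ0)]
      exact fun h' => h (hζ.pow_inj hb ha h').symm
    rw [geom_sum_eq hne, div_pow, ← pow_mul, ← pow_mul, mul_comm b, mul_comm a, pow_mul, pow_mul,
      hζ.pow_eq_one]
    simp

/-! ### Products of linear factors, the functionals and the interpolants -/

/-- The monic polynomial `∏ j, (X + w j)`. -/
noncomputable def linearProd {J : ℕ} (w : Fin J → ℂ) : ℂ[X] := ∏ j, (X + C (w j))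

/-- The product `∏ (X + w l)` over `l ≠ i`. -/
noncomputable def linearProdErase {J : ℕ} (w : Fin J → ℂ) (i : Fin J) : ℂ[X] :=
  ∏ l ∈ Finset.univ.erase i, (X + C (w l))

theorem linearProd_eval {J : ℕ} (w : Fin J → ℂ) (x : ℂ) :
    (linearProd w).eval x = ∏ j, (x + w j) := by
  simp [linearProd, eval_prod]

theorem linearProd_monic {J : ℕ} (w : Fin J → ℂ) : (linearProd w).Monic :=
  monic_prod_of_monic _ _ fun _ _ => monic_X_add_C _

theorem linearProd_natDegree {J : ℕ} (w : Fin J → ℂ) : (linearProd w).natDegree = J := by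
  rw [linearProd, natDegree_prod_of_monic _ _ fun _ _ => monic_X_add_C _]
  simp

theorem linearProdErase_eval {J : ℕ} (w : Fin J → ℂ) (i : Fin J) (x : ℂ) :
    (linearProdErase w i).eval x = ∏ l ∈ Finset.univ.erase i, (x + w l) := by
  simp [linearProdErase, eval_prod]

theorem add_mul_linearProdErase_eval {J : ℕ} (w : Fin J → ℂ) (i : Fin J) (x : ℂ) :
    (x + w i) * (linearProdErase w i).eval x = (linearProd w).eval x := by
  rw [linearProdErase_eval, linearProd_eval,
    Finset.mul_prod_erase _ (fun l => x + w l) (Finset.mem_univ i)]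

theorem linearProdErase_natDegree {J : ℕ} (w : Fin J → ℂ) (i : Fin J) :
    (linearProdErase w i).natDegree = J - 1 := by
  rw [linearProdErase, natDegree_prod_of_monic _ _ fun _ _ => monic_X_add_C _]
  simp

theorem linearProdErase_eval_neg_of_ne {J : ℕ} (w : Fin J → ℂ) {i l : Fin J} (h : l ≠ i) :
    (linearProdErase w i).eval (-w l) = 0 := by
  rw [linearProdErase_eval]
  exact Finset.prod_eq_zero (Finset.mem_erase.mpr ⟨h, Finset.mem_univ l⟩) (by simp)

theorem linearProdErase_eval_neg_ne_zero {J : ℕ} {w : Fin J → ℂ} (hw : Function.Injective w)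
    (i : Fin J) : (linearProdErase w i).eval (-w i) ≠ 0 := by
  rw [linearProdErase_eval, Finset.prod_ne_zero_iff]
  intro l hl h
  exact (Finset.mem_erase.mp hl).1 (hw (by linear_combination h))

theorem det_coeff_linearProd_mul_X_pow {J : ℕ} (N : ℕ) (w : Fin J → ℂ) :
    (Matrix.of fun b a : Fin N =>
      (linearProd w * X ^ (a : ℕ)).coeff (J + (b : ℕ))).det = 1 := by
  rw [Matrix.det_of_isUpperTriangular]
  · refine Finset.prod_eq_one fun a _ => ?_
    rw [Matrix.of_apply, coeff_mul_X_pow]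
    simpa [linearProd_natDegree] using (linearProd_monic w).coeff_natDegree
  · intro b a hab
    rw [Matrix.of_apply]
    apply coeff_eq_zero_of_natDegree_lt
    rw [(linearProd_monic w).natDegree_mul (monic_X_pow _), linearProd_natDegree, natDegree_X_pow]
    exact Nat.add_lt_add_left hab J

/-- The functional `p ↦ (1 / 2N) ∑ z^b p(1/z) / B(1/z)`, with `z` running over the powers of
`ζ`. -/
noncomputable def weightedCoeff (N : ℕ) (ζ : ℂ) (B : ℂ[X]) (b : ℕ) : ℂ[X] →ₗ[ℂ] ℂ :=
  ∑ x : Fin (2 * N), (1 / (2 * (N : ℂ)) * ((ζ ^ (x : ℕ)) ^ b / B.eval (ζ ^ (x : ℕ))⁻¹)) •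
    leval (ζ ^ (x : ℕ))⁻¹

theorem weightedCoeff_apply (N : ℕ) (ζ : ℂ) (B : ℂ[X]) (b : ℕ) (p : ℂ[X]) :
    weightedCoeff N ζ B b p = 1 / (2 * (N : ℂ)) * ∑ x : Fin (2 * N),
      (ζ ^ (x : ℕ)) ^ b * (p.eval (ζ ^ (x : ℕ))⁻¹ / B.eval (ζ ^ (x : ℕ))⁻¹) := by
  simp only [weightedCoeff, LinearMap.sum_apply, LinearMap.smul_apply, leval_apply, smul_eq_mul,
    Finset.mul_sum]
  exact Finset.sum_congr rfl fun x _ => by ring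

theorem weightedCoeff_mul_X_pow {N : ℕ} {ζ : ℂ} (hζ : IsPrimitiveRoot ζ (2 * N)) {B : ℂ[X]}
    (hB : ∀ x : ℕ, B.eval (ζ ^ x)⁻¹ ≠ 0) (a b : Fin N) :
    weightedCoeff N ζ B b (B * X ^ (a : ℕ)) = (1 : Matrix (Fin N) (Fin N) ℂ) b a := by
  have hN : (N : ℂ) ≠ 0 := by exact_mod_cast a.pos.ne'
  have h := sum_pow_mul_inv_pow hζ (a := a) (b := b) (by omega) (by omega)
  rw [weightedCoeff_apply]
  have h1 : ∀ x : Fin (2 * N), (ζ ^ (x : ℕ)) ^ (b : ℕ) * ((B * X ^ (a : ℕ)).eval (ζ ^ (x : ℕ))⁻¹ /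
      B.eval (ζ ^ (x : ℕ))⁻¹) = (ζ ^ (x : ℕ))⁻¹ ^ (a : ℕ) * (ζ ^ (x : ℕ)) ^ (b : ℕ) := by
    intro x
    rw [eval_mul, eval_pow, eval_X, mul_div_cancel_left₀ _ (hB x), mul_comm]
  simp_rw [h1, h, Matrix.one_apply, Fin.ext_iff, eq_comm (a := (b : ℕ))]
  split_ifs
  · push_cast; field_simp
  · simp

/-- The polynomials `(1 - (-u i X)^N) ∏ (X + u l)`, the product over `l ≠ i`. -/
noncomputable def interpolant (N : ℕ) {J : ℕ} (u : Fin J → ℂ) (i : Fin J) : ℂ[X] :=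
  (1 - C ((-u i) ^ N) * X ^ N) * linearProdErase u i

theorem interpolant_eval (N : ℕ) {J : ℕ} (u : Fin J → ℂ) (i : Fin J) (x : ℂ) :
    (interpolant N u i).eval x = (1 - (-u i) ^ N * x ^ N) * (linearProdErase u i).eval x := by
  simp [interpolant]

/-- Dividing by `B` leaves `(1 - (-u_i)^N w^N) / (w + u_i)`. Since `w^(2N) = 1`, this is `w^N` times
a geometric sum, with exponents from `N` to `2N - 1`, all orthogonal to the exponents `b < N`. -/
theorem weightedCoeff_interpolant {N J : ℕ} {ζ : ℂ} (hζ : IsPrimitiveRoot ζ (2 * N))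
    {u : Fin J → ℂ} (hB : ∀ x : ℕ, (linearProd u).eval (ζ ^ x)⁻¹ ≠ 0) (b : Fin N) (i : Fin J) :
    weightedCoeff N ζ (linearProd u) b (interpolant N u i) = 0 := by
  have hpt : ∀ x : Fin (2 * N), (ζ ^ (x : ℕ)) ^ (b : ℕ) *
      ((interpolant N u i).eval (ζ ^ (x : ℕ))⁻¹ / (linearProd u).eval (ζ ^ (x : ℕ))⁻¹) =
      ∑ k ∈ Finset.range N, (-u i) ^ (N - 1 - k) *
        ((ζ ^ (x : ℕ))⁻¹ ^ (N + k) * (ζ ^ (x : ℕ)) ^ (b : ℕ)) := by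
    intro x
    have hBx := hB x
    have hw : ((ζ ^ (x : ℕ))⁻¹) ^ (2 * N) = 1 := by
      rw [inv_pow, ← pow_mul, mul_comm, pow_mul, hζ.pow_eq_one, one_pow, inv_one]
    set w := (ζ ^ (x : ℕ))⁻¹
    have hgeom := Commute.geom_sum₂_mul (Commute.all w (-u i)) N
    rw [← add_mul_linearProdErase_eval u i] at hBx ⊢
    have h1 := left_ne_zero_of_mul hBx
    rw [interpolant_eval, mul_div_mul_right _ _ (right_ne_zero_of_mul hBx)]
    have h2 : (1 - (-u i) ^ N * w ^ N) / (w + u i) =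
        w ^ N * ∑ k ∈ Finset.range N, w ^ k * (-u i) ^ (N - 1 - k) := by
      rw [div_eq_iff h1]
      rw [two_mul, pow_add] at hw
      linear_combination -hw - w ^ N * hgeom
    rw [h2, Finset.mul_sum, Finset.mul_sum]
    exact Finset.sum_congr rfl fun k _ => by ring
  rw [weightedCoeff_apply]
  simp_rw [hpt]
  rw [Finset.sum_comm]
  refine mul_eq_zero_of_right _ (Finset.sum_eq_zero fun k hk => ?_)
  have hk := Finset.mem_range.mp hk
  rw [← Finset.mul_sum, sum_pow_mul_inv_pow hζ (by omega) (by omega), if_neg (by omega), mul_zero]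

theorem linearProd_mul_X_pow_degree_lt {N J : ℕ} (w : Fin J → ℂ) (a : Fin N) :
    (linearProd w * X ^ (a : ℕ)).degree < ((N + J : ℕ) : WithBot ℕ) := by
  refine degree_le_natDegree.trans_lt (Nat.cast_lt.mpr ?_)
  rw [(linearProd_monic w).natDegree_mul (monic_X_pow _), linearProd_natDegree, natDegree_X_pow]
  omega

theorem interpolant_degree_lt (N : ℕ) {J : ℕ} (u : Fin J → ℂ) (i : Fin J) :
    (interpolant N u i).degree < ((N + J : ℕ) : WithBot ℕ) := by
  refine degree_le_natDegree.trans_lt (Nat.cast_lt.mpr ?_)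
  have h1 : (1 - C ((-u i) ^ N) * X ^ N : ℂ[X]).natDegree ≤ N :=
    (natDegree_sub_le _ _).trans (max_le (by simp) (natDegree_C_mul_X_pow_le _ _))
  have h2 := linearProdErase_natDegree u i
  have h3 := natDegree_mul_le (p := (1 - C ((-u i) ^ N) * X ^ N : ℂ[X])) (q := linearProdErase u i)
  have := i.pos
  rw [interpolant]
  omega

/-! ### Exchange of bases and Cauchy matrices -/

/-- The Toeplitz determinant of `∏ (1 + v_j z) / ∏ (1 + u_j z)`, times determinants in `u` and
`v`, from two bases of the polynomials of degree less than `N + J`. -/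
theorem det_weightedCoeff_mul {N J : ℕ} {ζ : ℂ} (hζ : IsPrimitiveRoot ζ (2 * N))
    {u : Fin J → ℂ} (hB : ∀ x : ℕ, (linearProd u).eval (ζ ^ x)⁻¹ ≠ 0) (v : Fin J → ℂ) :
    (Matrix.of fun b a : Fin N =>
        weightedCoeff N ζ (linearProd u) b (linearProd v * X ^ (a : ℕ))).det *
      (Matrix.vandermonde fun j => -v j).det *
      ∏ i, (interpolant N u i).eval (-u i) =
    (Matrix.of fun j i => (interpolant N u i).eval (-v j)).det *
      (Matrix.vandermonde fun j => -u j).det := by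
  let f : Fin N ⊕ Fin J → ℂ[X] →ₗ[ℂ] ℂ :=
    Sum.elim (fun b => weightedCoeff N ζ (linearProd u) b) fun j => leval (-v j)
  let g : Fin N ⊕ Fin J → ℂ[X] →ₗ[ℂ] ℂ :=
    Sum.elim (fun b => lcoeff ℂ (J + b)) fun j => leval (-u j)
  let p : Fin N ⊕ Fin J → ℂ[X] :=
    Sum.elim (fun a => linearProd v * X ^ (a : ℕ)) fun k => X ^ (k : ℕ)
  let r : Fin N ⊕ Fin J → ℂ[X] :=
    Sum.elim (fun a => linearProd u * X ^ (a : ℕ)) fun i => interpolant N u i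
  have hv : ∀ (w : Fin J → ℂ) j, (linearProd w).eval (-w j) = 0 := fun w j => by
    rw [linearProd_eval]
    exact Finset.prod_eq_zero (Finset.mem_univ j) (by simp)
  have hp : ∀ i, (p i).degree < ((N + J : ℕ) : WithBot ℕ) := by
    rintro (a | k)
    · exact linearProd_mul_X_pow_degree_lt v a
    · exact (degree_X_pow_le _).trans_lt (Nat.cast_lt.mpr (by omega))
  have hr : ∀ i, (r i).degree < ((N + J : ℕ) : WithBot ℕ) := by
    rintro (a | i)
    · exact linearProd_mul_X_pow_degree_lt u a
    · exact interpolant_degree_lt N u i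
  have hfp : (Matrix.of fun i j => f i (p j)) = Matrix.fromBlocks
      (Matrix.of fun b a : Fin N =>
        weightedCoeff N ζ (linearProd u) b (linearProd v * X ^ (a : ℕ)))
      (Matrix.of fun (b : Fin N) (k : Fin J) =>
        weightedCoeff N ζ (linearProd u) b (X ^ (k : ℕ))) 0
      (Matrix.vandermonde fun j => -v j) := by
    ext (i | i) (j | j) <;> simp [f, p, hv, Matrix.vandermonde_apply]
  have hgr : (Matrix.of fun i j => g i (r j)) = Matrix.fromBlocks
      (Matrix.of fun b a : Fin N => (linearProd u * X ^ (a : ℕ)).coeff (J + (b : ℕ)))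
      (Matrix.of fun (b : Fin N) (k : Fin J) => (interpolant N u k).coeff (J + (b : ℕ))) 0
      (Matrix.diagonal fun i => (interpolant N u i).eval (-u i)) := by
    ext (i | i) (j | j)
    · simp [g, r]
    · simp [g, r]
    · simp [g, r, hv]
    · by_cases h : i = j
      · subst h; simp [g, r]
      · simp [g, r, h, interpolant_eval, linearProdErase_eval_neg_of_ne u h]
  have hgp : (Matrix.of fun i j => g i (p j)) = Matrix.fromBlocks
      (Matrix.of fun b a : Fin N => (linearProd v * X ^ (a : ℕ)).coeff (J + (b : ℕ))) 0
      (Matrix.of fun (l : Fin J) (a : Fin N) => (linearProd v * X ^ (a : ℕ)).eval (-u l))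
      (Matrix.vandermonde fun j => -u j) := by
    ext (i | i) (j | j)
    · simp [g, p]
    · simp only [Matrix.of_apply, g, p, Sum.elim_inl, Sum.elim_inr, lcoeff_apply, coeff_X_pow,
        Matrix.fromBlocks_apply₁₂, Matrix.zero_apply]
      rw [if_neg (by omega)]
    · simp [g, p]
    · simp [g, p, Matrix.vandermonde_apply]
  have hfr : (Matrix.of fun i j => f i (r j)) = Matrix.fromBlocks 1 0
      (Matrix.of fun (l : Fin J) (a : Fin N) => (linearProd u * X ^ (a : ℕ)).eval (-v l))
      (Matrix.of fun j i => (interpolant N u i).eval (-v j)) := by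
    ext (i | i) (j | j)
    · simpa [f, r] using weightedCoeff_mul_X_pow hζ hB j i
    · simpa [f, r] using weightedCoeff_interpolant hζ hB i j
    · simp [f, r]
    · simp [f, r]
  have key := det_pairing_exchange (n := N + J) (by simp) f g p r hp hr
  rw [hfp, hgr, hgp, hfr, Matrix.det_fromBlocks_zero₂₁, Matrix.det_fromBlocks_zero₂₁,
    Matrix.det_fromBlocks_zero₁₂, Matrix.det_fromBlocks_zero₁₂, det_coeff_linearProd_mul_X_pow,
    det_coeff_linearProd_mul_X_pow, Matrix.det_diagonal, Matrix.det_one] at key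
  simpa using key

/-- The same exchange in degree `< J`: the products are, up to scaling, the Lagrange basis at the
nodes `-u_j`. -/
theorem det_linearProdErase_eval {J : ℕ} (u v : Fin J → ℂ) :
    (Matrix.of fun j i => (linearProdErase u i).eval (-v j)).det *
        (Matrix.vandermonde fun j => -u j).det =
      (Matrix.vandermonde fun j => -v j).det * ∏ i, (linearProdErase u i).eval (-u i) := by
  have key := det_pairing_exchange (n := J) (by simp) (fun j => leval (-v j))
    (fun j => leval (-u j)) (fun k : Fin J => X ^ (k : ℕ)) (linearProdErase u)
    (fun k => (degree_X_pow_le _).trans_lt (Nat.cast_lt.mpr k.2)) (fun i => by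
      refine degree_le_natDegree.trans_lt (Nat.cast_lt.mpr ?_)
      rw [linearProdErase_natDegree]
      have := i.pos
      omega)
  have hd : (Matrix.of fun j i => (linearProdErase u i).eval (-u j)) =
      Matrix.diagonal fun i => (linearProdErase u i).eval (-u i) := by
    ext i j
    by_cases h : i = j
    · subst h; simp
    · simp [h, linearProdErase_eval_neg_of_ne u h]
  simp only [leval_apply, hd, Matrix.det_diagonal, eval_pow, eval_X] at key
  exact key.symm

/-- Pulling `∏ l, (u l - v j)` out of the rows turns the evaluations of `linearProdErase u` into a
Cauchy matrix. -/
theorem det_mul_linearProdErase_eval {J : ℕ} {u v : Fin J → ℂ} (huv : ∀ i j, v i ≠ u j)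
    (c : Fin J → Fin J → ℂ) :
    (Matrix.of fun j i => c i j * (linearProdErase u i).eval (-v j)).det =
      (∏ j, (linearProd u).eval (-v j)) *
        (Matrix.of fun i j => 1 / (u i - v j) * c i j).det := by
  rw [← Matrix.det_transpose (Matrix.of fun i j => 1 / (u i - v j) * c i j),
    ← Matrix.det_mul_column]
  congr 1
  ext j i
  have h : u i - v j ≠ 0 := sub_ne_zero.mpr (huv j i).symm
  simp only [Matrix.of_apply, Matrix.transpose_apply, ← add_mul_linearProdErase_eval u i]
  field_simp
  ring

/-! ### The average as a Toeplitz determinant -/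

theorem charDet_eq_prod {N : ℕ} (w : ℂ) (z : Fin N → ℂ) : charDet w z = ∏ i, (1 + w * z i) := by
  rw [charDet, ← Matrix.det_diagonal]
  congr 1
  ext i j
  by_cases h : i = j
  · subst h; simp
  · simp [h]

theorem isPrimitiveRoot_e {N : ℕ} (hN : 0 < N) :
    IsPrimitiveRoot (e (1 / (2 * (N : ℝ)))) (2 * N) := by
  have h := Complex.isPrimitiveRoot_exp (2 * N) (by omega)
  convert h using 1
  rw [e]
  push_cast
  congr 1
  ring

theorem points_apply (N : ℕ) (m : Fin N → Fin (2 * N)) (i : Fin N) :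
    points N m i = e (1 / (2 * (N : ℝ))) ^ (m i : ℕ) := by
  rw [points, e, e, ← Complex.exp_nat_mul]
  push_cast
  congr 1
  ring

/-- On the unit circle inversion is conjugation, so the second determinant is the conjugate of the
first. -/
theorem norm_sq_vandermondeProd {N : ℕ} {z : Fin N → ℂ} (hz : ∀ i, ‖z i‖ = 1) :
    ((‖vandermondeProd z‖ ^ 2 : ℝ) : ℂ) =
      (Matrix.of fun i b : Fin N => z i ^ (b : ℕ)).det *
        (Matrix.of fun i a : Fin N => (z i)⁻¹ ^ (a : ℕ)).det := by
  have h1 : ‖vandermondeProd z‖ = ‖(Matrix.vandermonde z).det‖ := by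
    rw [vandermondeProd, Matrix.det_vandermonde]
    simp_rw [norm_prod, norm_sub_rev]
  have h2 : (Matrix.of fun i a : Fin N => (z i)⁻¹ ^ (a : ℕ)) =
      (starRingEnd ℂ).mapMatrix (Matrix.vandermonde z) := by
    ext i a
    rw [Matrix.of_apply, Complex.inv_eq_conj (hz i)]
    simp [Matrix.vandermonde_apply]
  rw [h1, h2, ← RingHom.map_det]
  push_cast
  exact (Complex.mul_conj' _).symm

theorem linearProd_eval_inv_ne_zero {N J : ℕ} {ζ : ℂ} (hζ : ζ ^ (2 * N) = 1) {u : Fin J → ℂ}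
    (hu : ∀ i, u i ^ (2 * N) ≠ 1) (x : ℕ) : (linearProd u).eval (ζ ^ x)⁻¹ ≠ 0 := by
  rw [linearProd_eval, Finset.prod_ne_zero_iff]
  intro i _ h
  refine hu i ?_
  rw [eq_neg_of_add_eq_zero_right h, (even_two_mul N).neg_pow, inv_pow, ← pow_mul, mul_comm x,
    pow_mul, hζ, one_pow, inv_one]

theorem prod_one_add_mul {J : ℕ} (w : Fin J → ℂ) {z : ℂ} (hz : z ≠ 0) :
    ∏ j, (1 + w j * z) = z ^ J * (linearProd w).eval z⁻¹ := by
  rw [linearProd_eval]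
  have hJ : z ^ J = ∏ _j : Fin J, z := by simp
  rw [hJ, ← Finset.prod_mul_distrib]
  exact Finset.prod_congr rfl fun j _ => by field_simp

theorem ratioAverage_eq_det {N : ℕ} (hN : 0 < N) {J : ℕ} (u v : Fin J → ℂ) :
    ratioAverage N u v = (Matrix.of fun b a : Fin N =>
      weightedCoeff N (e (1 / (2 * (N : ℝ)))) (linearProd u) b
        (linearProd v * X ^ (a : ℕ))).det := by
  have hζ := isPrimitiveRoot_e hN
  have hpt := points_apply N
  set ζ := e (1 / (2 * (N : ℝ)))
  have hζ0 : ζ ≠ 0 := hζ.ne_zero (by omega)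
  have hnorm : ‖ζ‖ = 1 := hζ.norm'_eq_one (by omega)
  let h : Fin (2 * N) → ℂ := fun x =>
    (linearProd v).eval (ζ ^ (x : ℕ))⁻¹ / (linearProd u).eval (ζ ^ (x : ℕ))⁻¹
  have hf : ∀ m : Fin N → Fin (2 * N),
      (∏ j, charDet (v j) (points N m)) / (∏ j, charDet (u j) (points N m)) =
        ∏ i, h (m i) := by
    intro m
    simp_rw [charDet_eq_prod]
    rw [Finset.prod_comm, Finset.prod_comm (s := Finset.univ (α := Fin J)),
      ← Finset.prod_div_distrib]
    refine Finset.prod_congr rfl fun i _ => ?_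
    have hz : points N m i ≠ 0 := by rw [hpt]; exact pow_ne_zero _ hζ0
    rw [prod_one_add_mul v hz, prod_one_add_mul u hz, mul_div_mul_left _ _ (pow_ne_zero _ hz), hpt]
  have hsum := sum_prod_mul_det_mul_det h (fun (b : Fin N) x => (ζ ^ (x : ℕ)) ^ (b : ℕ))
    (fun (a : Fin N) x => (ζ ^ (x : ℕ))⁻¹ ^ (a : ℕ))
  have hM : (Matrix.of fun b a : Fin N =>
      weightedCoeff N ζ (linearProd u) b (linearProd v * X ^ (a : ℕ))) =
      (1 / (2 * (N : ℂ))) • Matrix.of fun b a : Fin N => ∑ x, h x *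
        (ζ ^ (x : ℕ)) ^ (b : ℕ) * (ζ ^ (x : ℕ))⁻¹ ^ (a : ℕ) := by
    ext b a
    rw [Matrix.of_apply, weightedCoeff_apply, Matrix.smul_apply, smul_eq_mul, Matrix.of_apply]
    congr 1
    refine Finset.sum_congr rfl fun x _ => ?_
    simp only [h, eval_mul, eval_pow, eval_X]
    ring
  rw [hM, Matrix.det_smul]
  simp only [ratioAverage, expectation, hf]
  have hsq := fun m => norm_sq_vandermondeProd (z := points N m) fun i => by
    rw [hpt, norm_pow, hnorm, one_pow]
  simp_rw [hsq, hpt]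
  rw [hsum, Fintype.card_fin]
  have hfac : ((N ! : ℕ) : ℂ) ≠ 0 := by exact_mod_cast N.factorial_ne_zero
  rw [one_div_pow]
  field_simp

/-! ### The formula at distinct parameters, and its limit -/

theorem det_vandermonde_neg_ne_zero {J : ℕ} {w : Fin J → ℂ} (hw : Function.Injective w) :
    (Matrix.vandermonde fun j => -w j).det ≠ 0 :=
  Matrix.det_vandermonde_ne_zero_iff.mpr (neg_injective.comp hw)

theorem prod_linearProd_eval_neg_mul_cauchyDet {J : ℕ} {u v : Fin J → ℂ}
    (huv : ∀ i j, v i ≠ u j) :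
    (∏ j, (linearProd u).eval (-v j)) * cauchyDet u v *
        (Matrix.vandermonde fun j => -u j).det =
      (Matrix.vandermonde fun j => -v j).det * ∏ i, (linearProdErase u i).eval (-u i) := by
  have h := det_mul_linearProdErase_eval huv fun _ _ => 1
  simp only [one_mul, mul_one] at h
  rw [cauchyDet, ← h, det_linearProdErase_eval]

theorem cauchyDet_ne_zero {J : ℕ} {u v : Fin J → ℂ} (huv : ∀ i j, v i ≠ u j)
    (hui : Function.Injective u) (hvi : Function.Injective v) : cauchyDet u v ≠ 0 := by
  intro h0
  have h := prod_linearProd_eval_neg_mul_cauchyDet huv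
  rw [h0, mul_zero, zero_mul] at h
  exact mul_ne_zero (det_vandermonde_neg_ne_zero hvi)
    (Finset.prod_ne_zero_iff.mpr fun i _ => linearProdErase_eval_neg_ne_zero hui i) h.symm

theorem prod_one_sub_mul_weightedDet {N J : ℕ} {u : Fin J → ℂ} (hu : ∀ i, u i ^ (2 * N) ≠ 1)
    (v : Fin J → ℂ) :
    (∏ i, (1 - u i ^ (2 * N))) * weightedDet N u v =
      (Matrix.of fun i j => 1 / (u i - v j) * (1 - u i ^ N * v j ^ N)).det := by
  rw [weightedDet, ← Matrix.det_mul_column]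
  congr 1
  ext i j
  have h : 1 - u i ^ (2 * N) ≠ 0 := sub_ne_zero.mpr (hu i).symm
  simp only [Matrix.of_apply, frakE]
  rw [mul_left_comm, mul_div_cancel₀ _ h]

theorem ratioAverage_eq {N J : ℕ} (hN : 0 < N) {u v : Fin J → ℂ}
    (hu : ∀ i, u i ^ (2 * N) ≠ 1) (huv : ∀ i j, v i ≠ u j)
    (hui : Function.Injective u) (hvi : Function.Injective v) :
    ratioAverage N u v = 1 / cauchyDet u v * weightedDet N u v := by
  have hζ := isPrimitiveRoot_e hN
  have key := det_weightedCoeff_mul hζ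
    (linearProd_eval_inv_ne_zero hζ.pow_eq_one hu) v
  rw [← ratioAverage_eq_det hN] at key
  have hsign : ∀ a b : ℂ, (-a) ^ N * (-b) ^ N = a ^ N * b ^ N := fun a b => by
    rw [← mul_pow, neg_mul_neg, mul_pow]
  simp_rw [interpolant_eval, hsign, ← pow_add, ← two_mul] at key
  rw [Finset.prod_mul_distrib,
    det_mul_linearProdErase_eval huv fun i j => 1 - u i ^ N * v j ^ N,
    ← prod_one_sub_mul_weightedDet hu] at key
  have hC := prod_linearProd_eval_neg_mul_cauchyDet huv
  have hC0 := cauchyDet_ne_zero huv hui hvi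
  have hV := det_vandermonde_neg_ne_zero hvi
  have hR : ∏ i, (linearProdErase u i).eval (-u i) ≠ 0 :=
    Finset.prod_ne_zero_iff.mpr fun i _ => linearProdErase_eval_neg_ne_zero hui i
  have hP : ∏ i, (1 - u i ^ (2 * N)) ≠ 0 :=
    Finset.prod_ne_zero_iff.mpr fun i _ => sub_ne_zero.mpr (hu i).symm
  rw [one_div_mul_eq_div, eq_div_iff hC0]
  -- Only the `v`-Vandermonde needs to be nonzero: `hC` trades the `u`-Vandermonde for it.
  refine mul_right_cancel₀ (mul_ne_zero (mul_ne_zero hV hR) hP) ?_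
  linear_combination cauchyDet u v * key +
    weightedDet N u v * (∏ i, (1 - u i ^ (2 * N))) * hC

theorem continuousAt_ratioAverage {N J : ℕ} (hN : 0 < N) {u : Fin J → ℂ}
    (hu : ∀ i, u i ^ (2 * N) ≠ 1) (v : Fin J → ℂ) :
    ContinuousAt (fun p : (Fin J → ℂ) × (Fin J → ℂ) => ratioAverage N p.1 p.2) (u, v) := by
  have hζ := isPrimitiveRoot_e hN
  simp only [ratioAverage, expectation, charDet_eq_prod]
  refine continuousAt_const.mul (tendsto_finsetSum _ fun m _ => ContinuousAt.mul
    (ContinuousAt.div (by fun_prop) (by fun_prop) ?_) continuousAt_const)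
  rw [Finset.prod_comm, Finset.prod_ne_zero_iff]
  intro i _
  have hz : points N m i ≠ 0 := by
    rw [points_apply]; exact pow_ne_zero _ (hζ.ne_zero (by omega))
  rw [prod_one_add_mul u hz, points_apply]
  rw [points_apply] at hz
  exact mul_ne_zero (pow_ne_zero _ hz) (linearProd_eval_inv_ne_zero hζ.pow_eq_one hu _)

theorem eventually_pow_ne_one_and_ne {N J : ℕ} {u v : Fin J → ℂ}
    (hu : ∀ i, u i ^ (2 * N) ≠ 1) (huv : ∀ i j, v i ≠ u j) :
    ∀ᶠ p : (Fin J → ℂ) × (Fin J → ℂ) in 𝓝 (u, v),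
      (∀ i, p.1 i ^ (2 * N) ≠ 1) ∧ ∀ i j, p.2 i ≠ p.1 j := by
  refine (eventually_all.mpr fun i => ?_).and
    (eventually_all.mpr fun i => eventually_all.mpr fun j => ?_)
  · exact ContinuousAt.eventually_ne (g := fun p : (Fin J → ℂ) × (Fin J → ℂ) => p.1 i ^ (2 * N))
      (by fun_prop) (hu i)
  · have h : ContinuousAt (fun p : (Fin J → ℂ) × (Fin J → ℂ) => p.2 i - p.1 j) (u, v) := by
      fun_prop
    exact (h.eventually_ne (sub_ne_zero.mpr (huv i j))).mono fun p hp => sub_ne_zero.mp hp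

end ACUE

/-- The formula for averages of ratios. If the `u_i` are pairwise distinct and the `v_j` are
pairwise distinct, the denominator on the right is nonzero and the formula is an equality of
complex numbers; for arbitrary `u` and `v` the right-hand side is understood as the limit from
such points. -/
theorem theorem1p4 (N J : ℕ) (hN : 0 < N) (hJ : 0 < J) (u v : Fin J → ℂ)
    (hu : ∀ i, u i ^ (2 * N) ≠ 1) (huv : ∀ i j, v i ≠ u j) :
    (Function.Injective u → Function.Injective v →
      ACUE.cauchyDet u v ≠ 0 ∧
        ACUE.ratioAverage N u v = 1 / ACUE.cauchyDet u v * ACUE.weightedDet N u v) ∧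
    Tendsto
      (fun p : (Fin J → ℂ) × (Fin J → ℂ) =>
        1 / ACUE.cauchyDet p.1 p.2 * ACUE.weightedDet N p.1 p.2)
      (𝓝[{p | Function.Injective p.1 ∧ Function.Injective p.2}] (u, v))
      (𝓝 (ACUE.ratioAverage N u v)) := by
  refine ⟨fun hui hvi => ⟨ACUE.cauchyDet_ne_zero huv hui hvi,
    ACUE.ratioAverage_eq hN hu huv hui hvi⟩, ?_⟩
  -- The conditions `hu` and `huv` are open, so near `(u, v)` the two sides agree at all points with
  -- distinct coordinates.
  refine Tendsto.congr' ?_ ((ACUE.continuousAt_ratioAverage hN hu v).mono_left nhdsWithin_le_nhds)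
  filter_upwards [self_mem_nhdsWithin,
    nhdsWithin_le_nhds (ACUE.eventually_pow_ne_one_and_ne hu huv)] with p hp hp'
  exact ACUE.ratioAverage_eq hN hp'.1 hp'.2 hp.1 hp.2
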